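/- All graphs are finite and simple. For a graph $G$, let $\rho(G)$ be the largest eigenvalue of its adjacency matrix; $G_1\vee G_2$ denotes the join and $G_1+G_2$ the disjoint union of two graphs, and $mK_1$ is the edgeless graph on $m$ vertices. A $k$-matching of $G$ is a function $f:E(G)\to\{0,1,\dots,k\}$ such that $\sum_{e\ni v}f(e)\le k$ for every vertex $v$. For $1\le d\le k$, the graph $G$ is $k$-$d$-critical if for every vertex $v$ there is a $k$-matching $f$ with $\sum_{e\ni v}f(e)=k-d$ and $\sum_{e\ni u}f(e)=k$ for every vertex $u\ne v$. Let $n\ge 3$, let $k\ge 3$ be odd, let $1\le d<k$ with $n\equiv d\pmod 2$, and let $G$ be a graph of order $n$. (1) If $n\ge 7$ or $n\in\{3,5\}$, and $\rho(G)\ge\rho(K_1\vee(K_{n-2}+K_1))$, then $G$ is $k$-$d$-critical unless $G\cong K_1\vee(K_{n-2}+K_1)$, in which case $G$ is not $k$-$d$-critical. (2) If $n\in\{4,6\}$ and $\rho(G)\ge\rho(K_{n/2}\vee\frac n2K_1)$, then $G$ is $k$-$d$-critical unless $G\cong K_{n/2}\vee\frac n2K_1$, in which case $G$ is not $k$-$d$-critical.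 -/

import Mathlib

namespace SimpleGraph

/-- The join `G ∨ H`: the disjoint union of `G` and `H` together with all edges between them. -/
def graphJoin {V W : Type*} (G : SimpleGraph V) (H : SimpleGraph W) : SimpleGraph (V ⊕ W) :=
  (G ⊕g H) ⊔ completeBipartiteGraph V W

/-- The graph `K₁ ∨ (K_{n-2} + K₁)` (used for `n ≥ 3`, where it has order `n`). -/
abbrev pendantCliqueGraph (n : ℕ) : SimpleGraph (Fin 1 ⊕ (Fin (n - 2) ⊕ Fin 1)) :=
  graphJoin (completeGraph (Fin 1)) (completeGraph (Fin (n - 2)) ⊕g completeGraph (Fin 1))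

/-- The graph `K_m ∨ m K₁`, of order `2m`; `m K₁` is the edgeless graph on `m` vertices. -/
abbrev halfSplitGraph (m : ℕ) : SimpleGraph (Fin m ⊕ Fin m) :=
  graphJoin (completeGraph (Fin m)) (emptyGraph (Fin m))

open scoped Classical in
/-- The adjacency spectral radius `ρ(G)`: the largest eigenvalue of the adjacency matrix. -/
noncomputable def adjRho {V : Type*} [Fintype V] (G : SimpleGraph V) : ℝ :=
  sSup (spectrum ℝ (G.adjMatrix ℝ))

open scoped Classical in
/-- On a nonempty vertex set the supremum defining `ρ(G)` is attained: `ρ(G)` really is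
the largest eigenvalue of the adjacency matrix. -/
theorem isGreatest_adjRho {V : Type*} [Fintype V] [Nonempty V] (G : SimpleGraph V) :
    IsGreatest (spectrum ℝ (G.adjMatrix ℝ)) G.adjRho := by
  have hA : (G.adjMatrix ℝ).IsHermitian := by
    rw [Matrix.IsHermitian, Matrix.conjTranspose_eq_transpose_of_trivial, transpose_adjMatrix]
  have hs := hA.spectrum_real_eq_range_eigenvalues
  have hfin : (spectrum ℝ (G.adjMatrix ℝ)).Finite := by
    rw [hs]; exact Set.finite_range _
  have hne : (spectrum ℝ (G.adjMatrix ℝ)).Nonempty := by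
    rw [hs]; exact Set.range_nonempty _
  exact ⟨hne.csSup_mem hfin, fun _ hx => le_csSup hfin.bddAbove hx⟩

open scoped Classical in
/-- The sum of `f e` over all edges `e` of `G` incident with `v`. -/
noncomputable def incidentSum {V : Type*} [Fintype V] (G : SimpleGraph V)
    (f : G.edgeSet → ℕ) (v : V) : ℕ :=
  ∑ e ∈ Finset.univ.filter (fun e : G.edgeSet => v ∈ (e : Sym2 V)), f e

/-- A `k`-matching of `G`: a function `f : E(G) → {0, 1, …, k}` whose sum over the edges
at each vertex is at most `k`. -/
def IsKMatching {V : Type*} [Fintype V] (G : SimpleGraph V) (k : ℕ) (f : G.edgeSet → ℕ) : Prop :=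
  (∀ e, f e ≤ k) ∧ ∀ v, G.incidentSum f v ≤ k

/-- `G` is `k`-`d`-critical (for `1 ≤ d ≤ k`): for every vertex `v` there is a `k`-matching whose
sum at `v` is `k - d` and whose sum at every other vertex is `k`. -/
def IsKDCritical {V : Type*} [Fintype V] (G : SimpleGraph V) (k d : ℕ) : Prop :=
  ∀ v : V, ∃ f : G.edgeSet → ℕ, G.IsKMatching k f ∧
    G.incidentSum f v = k - d ∧ ∀ u, u ≠ v → G.incidentSum f u = k

end SimpleGraph

/-! Criticality follows from two properties: every nonempty independent set has strictly more
neighbours than elements (`IndepExpanding`), and few pairs of vertices are non-adjacent.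

To build the weighting at a vertex `v`, start with a small one that gives sum `1` at every other
vertex and a sum of the parity of `k - d` at `v`. For even order this is a perfect matching. For odd
order it is a matching exposing only `v`, possibly with one missing edge replaced by two edges
through `v`. Such matchings come from averaging over a one-factorization of a complete graph. All
remaining demands are even; half of each is met by a transport supported on edges, which exists by
Hall's theorem and expansion, and adding its transpose doubles and symmetrizes it
(`IndepExpanding.exists_weights`).

The spectral hypothesis gives `ρ > n - 2`. Hong's bound then limits the number of ordered
non-adjacent pairs to `2(n - 2)`. If expansion fails, an independent `I` with at most `#I`
neighbours already accounts for so many such pairs that only a vertex of degree at most one or a few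
small configurations survive. The first case puts `G` inside the pendant clique graph, and counting
missing pairs gives an isomorphism. Configurations of order 5 and 8 violate `ρ > n - 2`; those of
order 4 and 6 yield the split graph.

Conversely, each extremal graph has an independent set with no more neighbours than elements, so no
deficiency can be placed on a neighbour. -/

namespace SimpleGraph

open Finset

/-! ### Bounds on the spectral radius -/

section Spectral

variable {V : Type*} (G : SimpleGraph V)

open scoped Classical in
/-- The `0`-`1` indicator of adjacency, with real values. -/
noncomputable def adjInd (u v : V) : ℝ := if G.Adj u v then 1 else 0

theorem adjInd_of_adj {u v : V} (h : G.Adj u v) : G.adjInd u v = 1 := by simp [adjInd, h]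

theorem adjInd_of_not_adj {u v : V} (h : ¬ G.Adj u v) : G.adjInd u v = 0 := by simp [adjInd, h]

theorem adjInd_nonneg (u v : V) : 0 ≤ G.adjInd u v := by
  unfold adjInd; split_ifs <;> norm_num

theorem adjInd_le_one (u v : V) : G.adjInd u v ≤ 1 := by
  unfold adjInd; split_ifs <;> norm_num

theorem adjInd_sq (u v : V) : G.adjInd u v ^ 2 = G.adjInd u v := by
  unfold adjInd; split_ifs <;> norm_num

theorem adjInd_comm (u v : V) : G.adjInd u v = G.adjInd v u := by
  by_cases h : G.Adj u v
  · rw [G.adjInd_of_adj h, G.adjInd_of_adj h.symm]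
  · rw [G.adjInd_of_not_adj h, G.adjInd_of_not_adj fun h' => h h'.symm]

variable [Fintype V]

theorem exists_eigenvector_adjRho [Nonempty V] :
    ∃ x : V → ℝ, x ≠ 0 ∧ ∀ u, ∑ v, G.adjInd u v * x v = G.adjRho * x u := by
  classical
  have h := G.isGreatest_adjRho.1
  rw [← Matrix.spectrum_toLin', ← Module.End.hasEigenvalue_iff_mem_spectrum] at h
  obtain ⟨x, hx⟩ := h.exists_hasEigenvector
  refine ⟨x, hx.2, fun u => ?_⟩
  have h1 := congrFun hx.apply_eq_smul u
  simp only [Matrix.toLin'_apply, Matrix.mulVec, dotProduct, adjMatrix_apply, Pi.smul_apply,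
    smul_eq_mul] at h1
  rw [← h1]
  refine Finset.sum_congr rfl fun v _ => ?_
  by_cases ha : G.Adj u v <;> simp [adjInd, ha]

/-- The Rayleigh quotient bounds the spectral radius from below. -/
theorem rayleigh_le_adjRho [Nonempty V] (x : V → ℝ) :
    ∑ u, ∑ v, G.adjInd u v * x v * x u ≤ G.adjRho * ∑ u, x u ^ 2 := by
  classical
  have hA : (G.adjMatrix ℝ).IsHermitian := by
    rw [Matrix.IsHermitian, Matrix.conjTranspose_eq_transpose_of_trivial, transpose_adjMatrix]
  have hg := G.isGreatest_adjRho
  have hI : (algebraMap ℝ (Matrix V V ℝ) G.adjRho).IsHermitian := by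
    rw [Matrix.algebraMap_eq_diagonal]
    exact Matrix.isHermitian_diagonal _
  have hp : (algebraMap ℝ (Matrix V V ℝ) G.adjRho - G.adjMatrix ℝ).PosSemidef := by
    rw [Matrix.posSemidef_iff_isHermitian_and_spectrum_nonneg]
    refine ⟨hI.sub hA, ?_⟩
    rw [← spectrum.singleton_sub_eq]
    rintro _ ⟨a, ha, b, hb, rfl⟩
    rw [Set.mem_singleton_iff] at ha
    subst ha
    exact sub_nonneg.2 (hg.2 (by convert hb))
  have h := hp.dotProduct_mulVec_nonneg x
  rw [Matrix.sub_mulVec, dotProduct_sub, Algebra.algebraMap_eq_smul_one, Matrix.smul_mulVec,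
    Matrix.one_mulVec] at h
  simp only [dotProduct, star_trivial, Pi.smul_apply, smul_eq_mul, Matrix.mulVec,
    adjMatrix_apply] at h
  have e1 : ∑ u, x u * (G.adjRho * x u) = G.adjRho * ∑ u, x u ^ 2 := by
    rw [Finset.mul_sum]
    exact Finset.sum_congr rfl fun u _ => by ring
  have e2 : ∑ u, x u * ∑ v, (if G.Adj u v then (1 : ℝ) else 0) * x v
      = ∑ u, ∑ v, G.adjInd u v * x v * x u := by
    refine Finset.sum_congr rfl fun u _ => ?_
    rw [Finset.mul_sum]
    refine Finset.sum_congr rfl fun v _ => ?_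
    by_cases ha : G.Adj u v <;> simp [adjInd, ha, mul_comm]
  rw [e1, e2] at h
  linarith

/-- A positive vector `y` with `A y ≤ l y` bounds the spectral radius by `l`. -/
theorem adjRho_le_of_pos_vector [Nonempty V] (y : V → ℝ) (hy : ∀ u, 0 < y u) (l : ℝ)
    (h : ∀ u, ∑ v, G.adjInd u v * y v ≤ l * y u) : G.adjRho ≤ l := by
  obtain ⟨x, hx0, hx⟩ := G.exists_eigenvector_adjRho
  -- The eigenvalue equation is read at the vertex where `|x|` is largest relative to `y`.
  obtain ⟨u, -, hu⟩ := Finset.exists_max_image univ (fun u => |x u| / y u) univ_nonempty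
  have hr : ∀ v, |x v| ≤ |x u| / y u * y v := fun v =>
    (div_le_iff₀ (hy v)).1 (hu v (mem_univ v))
  have hpos : 0 < |x u| := by
    by_contra hc
    have h0 : |x u| = 0 := le_antisymm (not_lt.1 hc) (abs_nonneg _)
    refine hx0 (funext fun v => ?_)
    have := hr v
    rw [h0, zero_div, zero_mul] at this
    exact abs_eq_zero.1 (le_antisymm this (abs_nonneg _))
  have h1 : G.adjRho * |x u| ≤ l * |x u| := by
    calc G.adjRho * |x u| ≤ |G.adjRho * x u| := by
          rw [abs_mul]
          exact mul_le_mul_of_nonneg_right (le_abs_self _) (abs_nonneg _)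
      _ = |∑ v, G.adjInd u v * x v| := by rw [hx u]
      _ ≤ ∑ v, |G.adjInd u v * x v| := Finset.abs_sum_le_sum_abs _ _
      _ ≤ ∑ v, |x u| / y u * (G.adjInd u v * y v) := by
          refine Finset.sum_le_sum fun v _ => ?_
          rw [abs_mul, abs_of_nonneg (G.adjInd_nonneg u v)]
          calc G.adjInd u v * |x v| ≤ G.adjInd u v * (|x u| / y u * y v) :=
                mul_le_mul_of_nonneg_left (hr v) (G.adjInd_nonneg u v)
            _ = _ := by ring
      _ = |x u| / y u * ∑ v, G.adjInd u v * y v := by rw [Finset.mul_sum]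
      _ ≤ |x u| / y u * (l * y u) :=
          mul_le_mul_of_nonneg_left (h u) (div_nonneg (abs_nonneg _) (hy u).le)
      _ = l * |x u| := by
          have := (hy u).ne'
          field_simp
  exact le_of_mul_le_mul_right h1 hpos

/-- Hong's bound `ρ² ≤ 2m - n + 1` for graphs without isolated vertices. -/
theorem adjRho_sq_le [Nonempty V] (hdeg : ∀ u, 1 ≤ ∑ v, G.adjInd u v) :
    G.adjRho ^ 2 ≤ ∑ u, ∑ v, G.adjInd u v - (Fintype.card V - 1) := by
  classical
  obtain ⟨x, hx0, hx⟩ := G.exists_eigenvector_adjRho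
  set D : V → ℝ := fun u => ∑ v, G.adjInd u v with hD
  have hS : 0 < ∑ v, x v ^ 2 := by
    obtain ⟨w, hw⟩ := Function.ne_iff.1 hx0
    exact Finset.sum_pos' (fun v _ => sq_nonneg _) ⟨w, mem_univ _, sq_pos_of_ne_zero hw⟩
  -- Cauchy–Schwarz over the neighbours of `u`, using that the indicator is its own square.
  have h1 : ∀ u, (G.adjRho * x u) ^ 2 ≤ D u * ∑ v, G.adjInd u v * x v ^ 2 := fun u => by
    rw [← hx u]
    have := Finset.sum_mul_sq_le_sq_mul_sq univ (fun v => G.adjInd u v)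
      (fun v => G.adjInd u v * x v)
    have e : ∀ v, G.adjInd u v * (G.adjInd u v * x v) = G.adjInd u v * x v := fun v => by
      rw [← mul_assoc, ← sq, adjInd_sq]
    simpa only [e, adjInd_sq, mul_pow] using this
  have h2 : G.adjRho ^ 2 * ∑ v, x v ^ 2 ≤ ∑ v, (∑ u, D u * G.adjInd u v) * x v ^ 2 := by
    calc G.adjRho ^ 2 * ∑ v, x v ^ 2 = ∑ u, (G.adjRho * x u) ^ 2 := by
          simp only [mul_pow, Finset.mul_sum]
      _ ≤ ∑ u, D u * ∑ v, G.adjInd u v * x v ^ 2 := Finset.sum_le_sum fun u _ => h1 u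
      _ = _ := by
          simp only [Finset.mul_sum, Finset.sum_mul]
          rw [Finset.sum_comm]
          simp only [mul_assoc]
  -- The vertices left out of the neighbourhood of `v` are `v`, of degree `D v`, and `n - 1 - D v`
  -- others, each of degree at least `1`; together they account for at least `n - 1`.
  have h3 : ∀ v, ∑ u, D u * G.adjInd u v ≤ ∑ u, D u - (Fintype.card V - 1) := fun v => by
    have : ∀ u, (1 - G.adjInd u v) + (if u = v then D v - 1 else 0)
        ≤ D u - D u * G.adjInd u v := fun u => by
      by_cases huv : u = v
      · subst huv
        rw [G.adjInd_of_not_adj (G.irrefl)]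
        simp
      · rw [if_neg huv]
        nlinarith [hdeg u, G.adjInd_le_one u v]
    have hs := Finset.sum_le_sum fun u (_ : u ∈ univ) => this u
    rw [Finset.sum_add_distrib, Finset.sum_sub_distrib, Finset.sum_sub_distrib,
      Finset.sum_ite_eq' univ v] at hs
    have hDv : ∑ u, G.adjInd u v = D v := Finset.sum_congr rfl fun u _ => G.adjInd_comm u v
    simp only [mem_univ, if_true, hDv, Finset.sum_const, card_univ, nsmul_eq_mul, mul_one] at hs
    linarith
  have h4 : G.adjRho ^ 2 * ∑ v, x v ^ 2 ≤
      (∑ u, D u - (Fintype.card V - 1)) * ∑ v, x v ^ 2 := by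
    refine h2.trans ?_
    rw [Finset.mul_sum]
    exact Finset.sum_le_sum fun v _ => mul_le_mul_of_nonneg_right (h3 v) (sq_nonneg _)
  exact le_of_mul_le_mul_right h4 hS

/-- A graph with `ρ > n - 2` has no isolated vertex. -/
theorem one_le_sum_adjInd [Nonempty V] (hρ : (Fintype.card V : ℝ) - 2 < G.adjRho)
    (hn : 2 ≤ Fintype.card V) (u : V) : 1 ≤ ∑ v, G.adjInd u v := by
  classical
  by_contra hu
  have hz : ∀ v, ¬ G.Adj u v := fun v hv => hu <| by
    rw [← G.adjInd_of_adj hv]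
    exact Finset.single_le_sum (f := fun v => G.adjInd u v)
      (fun v _ => G.adjInd_nonneg u v) (mem_univ v)
  refine hρ.not_ge (G.adjRho_le_of_pos_vector (fun _ => 1) (fun _ => one_pos) _ fun w => ?_)
  simp only [mul_one]
  by_cases hw : w = u
  · subst hw
    rw [Finset.sum_eq_zero fun v _ => G.adjInd_of_not_adj (hz v)]
    have : (2 : ℝ) ≤ Fintype.card V := by exact_mod_cast hn
    linarith
  · calc ∑ v, G.adjInd w v ≤ ∑ v, (1 - (if v = w then 1 else 0) - (if v = u then 1 else 0)) := by
          refine Finset.sum_le_sum fun v _ => ?_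
          by_cases h1 : v = w
          · subst h1; simp [hw, G.adjInd_of_not_adj G.irrefl]
          · by_cases h2 : v = u
            · subst h2
              rw [G.adjInd_of_not_adj fun h => hz w h.symm]; simp [h1]
            · simpa [h1, h2] using G.adjInd_le_one w v
      _ = (Fintype.card V : ℝ) - 2 := by
          simp only [Finset.sum_sub_distrib, Finset.sum_ite_eq', mem_univ, if_true,
            Finset.sum_const, card_univ, nsmul_eq_mul, mul_one]
          ring

/-- A vector with two values bounds the spectral radius of a graph with an independent set. -/
theorem adjRho_le_of_indep [Nonempty V] (I : Finset V) (hI : ∀ u ∈ I, ∀ v ∈ I, ¬ G.Adj u v)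
    {c l : ℝ} (hc : 0 < c) (h1 : (Fintype.card V : ℝ) - #I ≤ l * c)
    (h2 : (Fintype.card V : ℝ) - #I - 1 + #I * c ≤ l) : G.adjRho ≤ l := by
  classical
  refine G.adjRho_le_of_pos_vector (fun u => if u ∈ I then c else 1)
    (fun u => by split_ifs <;> linarith) l fun u => ?_
  have e : ∀ a b : ℝ, ∑ v, (if v ∈ I then a else b) = #I * a + (Fintype.card V - #I) * b := by
    intro a b
    rw [Finset.sum_ite, Finset.sum_const, Finset.sum_const, Finset.filter_mem_eq_inter,
      Finset.univ_inter, ← Finset.compl_filter, Finset.card_compl, Finset.filter_mem_eq_inter,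
      Finset.univ_inter, nsmul_eq_mul, nsmul_eq_mul, Nat.cast_sub (Finset.card_le_univ I)]
  by_cases hu : u ∈ I
  · rw [if_pos hu]
    calc ∑ v, G.adjInd u v * (if v ∈ I then c else 1)
          ≤ ∑ v, (if v ∈ I then (0 : ℝ) else 1) := by
          refine Finset.sum_le_sum fun v _ => ?_
          by_cases hv : v ∈ I
          · simp [hv, G.adjInd_of_not_adj (hI u hu v hv)]
          · simpa [hv] using G.adjInd_le_one u v
      _ ≤ l * c := by rw [e]; linarith
  · rw [if_neg hu]
    calc ∑ v, G.adjInd u v * (if v ∈ I then c else 1)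
          ≤ ∑ v, ((if v ∈ I then c else 1) - (if v = u then 1 else 0)) := by
          refine Finset.sum_le_sum fun v _ => ?_
          by_cases hv : v = u
          · subst hv; simp [hu, G.adjInd_of_not_adj G.irrefl]
          · rw [if_neg hv, sub_zero]
            refine mul_le_of_le_one_left ?_ (G.adjInd_le_one u v)
            split_ifs <;> linarith
      _ ≤ l * 1 := by
          rw [Finset.sum_sub_distrib, e, Finset.sum_ite_eq' univ u]
          simp only [mem_univ, if_true]
          linarith

end Spectral

/-! ### Lower bounds for the extremal graphs -/

section Extremal

theorem graphJoin_adj_inl_inl {V W : Type*} {G : SimpleGraph V} {H : SimpleGraph W} (a b : V) :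
    (graphJoin G H).Adj (Sum.inl a) (Sum.inl b) ↔ G.Adj a b := by
  simp [graphJoin]

theorem graphJoin_adj_inl_inr {V W : Type*} {G : SimpleGraph V} {H : SimpleGraph W} (a : V)
    (b : W) : (graphJoin G H).Adj (Sum.inl a) (Sum.inr b) := by
  simp [graphJoin]

theorem graphJoin_adj_inr_inl {V W : Type*} {G : SimpleGraph V} {H : SimpleGraph W} (a : V)
    (b : W) : (graphJoin G H).Adj (Sum.inr b) (Sum.inl a) := by
  simp [graphJoin]

theorem graphJoin_adj_inr_inr {V W : Type*} {G : SimpleGraph V} {H : SimpleGraph W} (a b : W) :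
    (graphJoin G H).Adj (Sum.inr a) (Sum.inr b) ↔ H.Adj a b := by
  simp [graphJoin]

theorem sum_ite_ne_fin {m : ℕ} (i : Fin m) :
    ∑ j, (if i ≠ j then (1 : ℝ) else 0) = m - 1 := by
  have : ∀ j, (if i ≠ j then (1 : ℝ) else 0) = 1 - if i = j then 1 else 0 := fun j => by
    by_cases h : i = j <;> simp [h]
  rw [Finset.sum_congr rfl fun j _ => this j, Finset.sum_sub_distrib, Finset.sum_ite_eq]
  simp

/-- The quadratic form of `K₁ ∨ (K_{n-2} + K₁)` at a vector that is `1` off the pendant vertex. -/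
theorem sum_adjInd_pendantCliqueGraph (n : ℕ) (c : ℝ) :
    let x : Fin 1 ⊕ (Fin (n - 2) ⊕ Fin 1) → ℝ :=
      Sum.elim (fun _ => 1) (Sum.elim (fun _ => 1) (fun _ => c))
    ∑ u, ∑ v, (pendantCliqueGraph n).adjInd u v * x v * x u
      = ((n - 2 : ℕ) : ℝ) * ((n - 2 : ℕ) + 1) + 2 * c := by
  have e : ∀ i : Fin (n - 2), ∑ j, (completeGraph (Fin (n - 2))).adjInd i j
      = ((n - 2 : ℕ) : ℝ) - 1 := fun i => by
    rw [← sum_ite_ne_fin i]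
    exact Finset.sum_congr rfl fun j _ => by simp [adjInd]
  have e' : ∀ i j, (pendantCliqueGraph n).adjInd (Sum.inr (Sum.inl i)) (Sum.inr (Sum.inl j))
      = (completeGraph (Fin (n - 2))).adjInd i j := fun i j => by
    simp [adjInd, graphJoin]
  have a1 : ∀ i j, (pendantCliqueGraph n).adjInd (Sum.inl i) (Sum.inl j) = 0 := fun i j =>
    adjInd_of_not_adj _ (by rw [graphJoin_adj_inl_inl]; simp [Subsingleton.elim i j])
  have a2 : ∀ i j, (pendantCliqueGraph n).adjInd (Sum.inl i) (Sum.inr j) = 1 := fun i j =>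
    adjInd_of_adj _ (graphJoin_adj_inl_inr i j)
  have a3 : ∀ i j, (pendantCliqueGraph n).adjInd (Sum.inr i) (Sum.inl j) = 1 := fun i j =>
    adjInd_of_adj _ (graphJoin_adj_inr_inl j i)
  have a4 : ∀ i j, (pendantCliqueGraph n).adjInd (Sum.inr (Sum.inr i)) (Sum.inr j) = 0 :=
    fun i j => adjInd_of_not_adj _ (by
      rw [graphJoin_adj_inr_inr]; cases j <;> simp [Subsingleton.elim _ (0 : Fin 1)])
  have a5 : ∀ i j, (pendantCliqueGraph n).adjInd (Sum.inr (Sum.inl i)) (Sum.inr (Sum.inr j)) = 0 :=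
    fun i j => adjInd_of_not_adj _ (by rw [graphJoin_adj_inr_inr]; simp)
  simp only [Fintype.sum_sum_type, Sum.elim_inl, Sum.elim_inr, e', a1, a2, a3, a4, a5, mul_one,
    one_mul, zero_mul, zero_add, add_zero, Finset.sum_add_distrib, e, Finset.sum_const, card_univ,
    Fintype.card_fin, nsmul_eq_mul, Nat.cast_one]
  ring

theorem sub_two_lt_adjRho_pendantCliqueGraph {n : ℕ} (hn : 3 ≤ n) :
    (n : ℝ) - 2 < (pendantCliqueGraph n).adjRho := by
  -- Weight `c` on the pendant vertex adds `2c` to the form of the `(n-1)`-clique and costs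
  -- `(n-2)c²`; `c = 1/n` leaves a strict gain.
  have h := (pendantCliqueGraph n).rayleigh_le_adjRho
    (Sum.elim (fun _ => 1) (Sum.elim (fun _ => 1) (fun _ => (n : ℝ)⁻¹)))
  rw [sum_adjInd_pendantCliqueGraph] at h
  simp only [Fintype.sum_sum_type, Sum.elim_inl, Sum.elim_inr, Finset.sum_const, card_univ,
    Fintype.card_fin, nsmul_eq_mul, Nat.cast_one, one_pow, mul_one, one_mul] at h
  rw [Nat.cast_sub (by omega)] at h
  push_cast at h
  have hn' : (3 : ℝ) ≤ n := by exact_mod_cast hn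
  by_contra hc
  have hc' := mul_le_mul_of_nonneg_right (not_lt.1 hc)
    (by nlinarith [sq_nonneg (n : ℝ)⁻¹] : 0 ≤ 1 + ((n : ℝ) - 2 + (n : ℝ)⁻¹ ^ 2))
  have hi : (0 : ℝ) < (n : ℝ)⁻¹ := by positivity
  have hi' : (n : ℝ) * (n : ℝ)⁻¹ = 1 := mul_inv_cancel₀ (by positivity)
  nlinarith [mul_pos hi hi]

/-- The quadratic form of `K_m ∨ m K₁` at a vector that is `1` on the clique. -/
theorem sum_adjInd_halfSplitGraph (m : ℕ) (c : ℝ) :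
    let x : Fin m ⊕ Fin m → ℝ := Sum.elim (fun _ => 1) (fun _ => c)
    ∑ u, ∑ v, (halfSplitGraph m).adjInd u v * x v * x u
      = (m : ℝ) * (m - 1) + 2 * m ^ 2 * c := by
  have e : ∀ i : Fin m, ∑ j, (halfSplitGraph m).adjInd (Sum.inl i) (Sum.inl j)
      = (m : ℝ) - 1 := fun i => by
    rw [← sum_ite_ne_fin i]
    exact Finset.sum_congr rfl fun j _ => by simp [adjInd, graphJoin]
  have a2 : ∀ i j, (halfSplitGraph m).adjInd (Sum.inl i) (Sum.inr j) = 1 := fun i j =>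
    adjInd_of_adj _ (graphJoin_adj_inl_inr i j)
  have a3 : ∀ i j, (halfSplitGraph m).adjInd (Sum.inr i) (Sum.inl j) = 1 := fun i j =>
    adjInd_of_adj _ (graphJoin_adj_inr_inl j i)
  have a4 : ∀ i j, (halfSplitGraph m).adjInd (Sum.inr i) (Sum.inr j) = 0 :=
    fun i j => adjInd_of_not_adj _ (by rw [graphJoin_adj_inr_inr]; simp)
  simp only [Fintype.sum_sum_type, Sum.elim_inl, Sum.elim_inr, a2, a3, a4, mul_one,
    one_mul, zero_mul, Finset.sum_add_distrib, e, Finset.sum_const, card_univ,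
    Fintype.card_fin, nsmul_eq_mul]
  ring

theorem le_adjRho_halfSplitGraph_two : 5 / 2 ≤ (halfSplitGraph 2).adjRho := by
  have h := (halfSplitGraph 2).rayleigh_le_adjRho (Sum.elim (fun _ => 1) (fun _ => 1))
  rw [sum_adjInd_halfSplitGraph] at h
  simp only [Fintype.sum_sum_type, Sum.elim_inl, Sum.elim_inr, Finset.sum_const, card_univ,
    Fintype.card_fin, nsmul_eq_mul] at h
  norm_num at h
  linarith

/-- The exact value is `1 + √10 ≈ 4.162`. The weight `3/4` approximates the eigenvector closely
enough that `25 - ρ² < 8`, which is what the count of missing pairs needs. -/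
theorem le_adjRho_halfSplitGraph_three : 4.16 ≤ (halfSplitGraph 3).adjRho := by
  have h := (halfSplitGraph 3).rayleigh_le_adjRho (Sum.elim (fun _ => 1) (fun _ => 3 / 4))
  rw [sum_adjInd_halfSplitGraph] at h
  simp only [Fintype.sum_sum_type, Sum.elim_inl, Sum.elim_inr, Finset.sum_const, card_univ,
    Fintype.card_fin, nsmul_eq_mul] at h
  norm_num at h ⊢
  linarith

end Extremal

end SimpleGraph

namespace SimpleGraph

open Finset

/-! ### One-factorizations of complete graphs of even order -/

section Factorization

/-- The involutions of a perfect `1`-factorization of the complete graph on `Option (ZMod m)`,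
for odd `m`. -/
def optionInvolution {m : ℕ} (j : ZMod m) : Option (ZMod m) → Option (ZMod m)
  | none => some j
  | some a => if a = j then none else some (2 * j - a)

theorem two_mul_cancel_zmod {m : ℕ} (hm : Odd m) {a b : ZMod m} (h : 2 * a = 2 * b) : a = b := by
  have hu : IsUnit (2 : ZMod m) := by
    have := (ZMod.isUnit_iff_coprime 2 m).2 (Nat.coprime_two_left.2 hm)
    simpa using this
  exact hu.mul_left_cancel h

theorem optionInvolution_involutive {m : ℕ} (j : ZMod m) (x : Option (ZMod m)) :
    optionInvolution j (optionInvolution j x) = x := by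
  rcases x with _ | a
  · simp [optionInvolution]
  · by_cases h : a = j
    · simp [optionInvolution, h]
    · have : 2 * j - a ≠ j := fun h' => h (by linear_combination -h')
      simp [optionInvolution, h, this]

theorem optionInvolution_ne {m : ℕ} (hm : Odd m) (j : ZMod m) (x : Option (ZMod m)) :
    optionInvolution j x ≠ x := by
  rcases x with _ | a
  · simp [optionInvolution]
  · by_cases h : a = j
    · simp [optionInvolution, h]
    · have : 2 * j - a ≠ a := fun h' =>
        h (two_mul_cancel_zmod hm (by linear_combination -h'))
      simp [optionInvolution, h, this]

/-- In the round-robin pairing `a ↔ 2j - a`, agreement at a point off the centres forces `2j = 2j'`,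
and `2` is invertible modulo an odd `m`. -/
theorem optionInvolution_injective {m : ℕ} (hm : Odd m) {j j' : ZMod m} {x : Option (ZMod m)}
    (h : optionInvolution j x = optionInvolution j' x) : j = j' := by
  rcases x with _ | a
  · simpa [optionInvolution] using h
  · by_cases h1 : a = j
    · by_cases h2 : a = j'
      · exact h1.symm.trans h2
      · simp [optionInvolution, h1, h1 ▸ h2] at h
    · by_cases h2 : a = j'
      · simp [optionInvolution, h2, h2 ▸ h1] at h
      · simp only [optionInvolution, h1, h2, if_false, Option.some.injEq, sub_left_inj] at h
        exact two_mul_cancel_zmod hm h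

/-- A complete graph of even order `m + 1` decomposes into `m` perfect matchings. -/
theorem exists_oneFactorization {W : Type*} [Fintype W] {m : ℕ} (hm : Odd m)
    (hW : Fintype.card W = m + 1) :
    ∃ F : Fin m → W → W, (∀ j x, F j (F j x) = x) ∧ (∀ j x, F j x ≠ x) ∧
      ∀ j j' x, F j x = F j' x → j = j' := by
  have : NeZero m := ⟨by rintro rfl; simp at hm⟩
  obtain ⟨e⟩ : Nonempty (W ≃ Option (ZMod m)) := by
    rw [← Fintype.card_eq, hW, Fintype.card_option, ZMod.card]
  obtain ⟨s⟩ : Nonempty (Fin m ≃ ZMod m) := by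
    rw [← Fintype.card_eq, ZMod.card, Fintype.card_fin]
  refine ⟨fun j x => e.symm (optionInvolution (s j) (e x)), fun j x => ?_, fun j x h => ?_,
    fun j j' x h => ?_⟩
  · simp [optionInvolution_involutive]
  · exact optionInvolution_ne hm (s j) (e x) (by simpa using congrArg e h)
  · exact s.injective (optionInvolution_injective hm (e.symm.injective h))

end Factorization

/-! ### Transports, expansion and edge weightings -/

section Transport

variable {V : Type*} [Fintype V] (G : SimpleGraph V)

open scoped Classical in
/-- The set of vertices with a neighbour in `A`. -/
noncomputable def nbhd (A : Finset V) : Finset V := univ.filter fun x => ∃ u ∈ A, G.Adj u x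

theorem mem_nbhd {A : Finset V} {x : V} : x ∈ G.nbhd A ↔ ∃ u ∈ A, G.Adj u x := by
  simp [nbhd]

/-- Every nonempty independent set has more neighbours than elements. -/
def IndepExpanding : Prop :=
  ∀ I : Finset V, I.Nonempty → (∀ u ∈ I, ∀ v ∈ I, ¬ G.Adj u v) → #I < #(G.nbhd I)

/-- Blow each vertex `v` up into `c v` copies. Hall's theorem gives an injection of the copies along
edges, which is a permutation by finiteness; `x u v` counts the copies of `u` sent to copies of `v`.
-/
theorem exists_transport (c : V → ℕ)
    (hc : ∀ A : Finset V, ∑ u ∈ A, c u ≤ ∑ u ∈ G.nbhd A, c u) :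
    ∃ x : V → V → ℕ, (∀ u v, ¬ G.Adj u v → x u v = 0) ∧ (∀ u, ∑ v, x u v = c u) ∧
      ∀ v, ∑ u, x u v = c v := by
  classical
  let t : (Σ v, Fin (c v)) → Finset (Σ v, Fin (c v)) := fun s => univ.filter fun r => G.Adj s.1 r.1
  have hsig : ∀ A : Finset V, #((univ : Finset (Σ v, Fin (c v))).filter fun r => r.1 ∈ A)
      = ∑ u ∈ A, c u := fun A => by
    have : (univ : Finset (Σ v, Fin (c v))).filter (fun r => r.1 ∈ A)
        = A.sigma fun _ => univ := by
      ext r; simp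
    rw [this, Finset.card_sigma]; simp
  have hall : ∀ s : Finset (Σ v, Fin (c v)), #s ≤ #(s.biUnion t) := fun s => by
    have e1 : s ⊆ univ.filter fun r => r.1 ∈ s.image Sigma.fst := fun r hr => by
      simpa using ⟨r.2, hr⟩
    have e2 : s.biUnion t = univ.filter fun r => r.1 ∈ G.nbhd (s.image Sigma.fst) := by
      ext r
      simp only [t, mem_biUnion, mem_filter, mem_univ, true_and, mem_nbhd, mem_image]
      exact ⟨fun ⟨a, ha, h⟩ => ⟨a.1, ⟨a, ha, rfl⟩, h⟩, fun ⟨_, ⟨a, ha, rfl⟩, h⟩ => ⟨a, ha, h⟩⟩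
    calc #s ≤ _ := Finset.card_le_card e1
      _ = _ := hsig _
      _ ≤ _ := hc _
      _ = _ := (hsig _).symm
      _ = _ := by rw [e2]
  obtain ⟨f, hf, hft⟩ := (Finset.all_card_le_biUnion_card_iff_exists_injective t).1 hall
  have hbij : Function.Bijective f := Finite.injective_iff_bijective.1 hf
  refine ⟨fun u v => #(univ.filter fun i : Fin (c u) => (f ⟨u, i⟩).1 = v), fun u v h => ?_,
    fun u => ?_, fun v => ?_⟩
  · rw [Finset.card_eq_zero, Finset.filter_eq_empty_iff]
    rintro i - rfl
    have := hft ⟨u, i⟩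
    simp only [t, mem_filter] at this
    exact h this.2
  · have := Finset.card_eq_sum_card_fiberwise (s := (univ : Finset (Fin (c u))))
      (t := (univ : Finset V)) (f := fun i => (f ⟨u, i⟩).1) (fun _ _ => by simp)
    rw [Finset.card_univ, Fintype.card_fin] at this
    exact this.symm
  · have e : ∑ u, #(univ.filter fun i : Fin (c u) => (f ⟨u, i⟩).1 = v)
        = #(univ.filter fun s => (f s).1 = v) := by
      rw [← Finset.card_sigma]
      congr 1
      ext s
      simp
    rw [e]
    have e2 : #(univ.filter fun s => (f s).1 = v)
        = #((univ : Finset (Σ v, Fin (c v))).filter fun r => r.1 ∈ ({v} : Finset V)) := by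
      refine Finset.card_bij (fun s _ => f s) (fun s hs => by simpa using hs)
        (fun _ _ _ _ h => hf h) fun r hr => ?_
      obtain ⟨s, rfl⟩ := hbij.2 r
      exact ⟨s, by simpa using hr, rfl⟩
    rw [e2, hsig]; simp

/-- Vertices of `A` with a neighbour in `A` already lie in the neighbourhood, so only the
independent rest `I` must be paid for, by neighbours disjoint from those. The strict surplus of `I`
allows the possibly lighter vertex `v` to be discarded. -/
theorem IndepExpanding.sum_le (hG : G.IndepExpanding) {c : V → ℕ} {m : ℕ} {v : V}
    (hm : ∀ u, u ≠ v → c u = m) (hv : c v ≤ m) (A : Finset V) :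
    ∑ u ∈ A, c u ≤ ∑ u ∈ G.nbhd A, c u := by
  classical
  set I := A \ G.nbhd A with hI
  have hle : ∀ u, c u ≤ m := fun u => by
    by_cases h : u = v
    · exact h ▸ hv
    · exact (hm u h).le
  have hd : Disjoint (G.nbhd I) (A ∩ G.nbhd A) := by
    rw [Finset.disjoint_left]
    intro x hx hx'
    obtain ⟨u, hu, hux⟩ := G.mem_nbhd.1 hx
    rw [hI, mem_sdiff] at hu
    exact hu.2 (G.mem_nbhd.2 ⟨x, (mem_inter.1 hx').1, hux.symm⟩)
  have hsub : G.nbhd I ∪ (A ∩ G.nbhd A) ⊆ G.nbhd A := by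
    refine union_subset (fun x hx => ?_) inter_subset_right
    obtain ⟨u, hu, hux⟩ := G.mem_nbhd.1 hx
    exact G.mem_nbhd.2 ⟨u, (mem_sdiff.1 hu).1, hux⟩
  have hA : ∑ u ∈ A, c u = ∑ u ∈ I, c u + ∑ u ∈ A ∩ G.nbhd A, c u := by
    rw [hI, ← Finset.sum_union (Finset.disjoint_sdiff_inter A _), Finset.sdiff_union_inter]
  have hN : ∑ u ∈ G.nbhd I, c u + ∑ u ∈ A ∩ G.nbhd A, c u ≤ ∑ u ∈ G.nbhd A, c u := by
    rw [← Finset.sum_union hd]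
    exact Finset.sum_le_sum_of_subset hsub
  have hIN : ∑ u ∈ I, c u ≤ ∑ u ∈ G.nbhd I, c u := by
    rcases I.eq_empty_or_nonempty with h0 | h0
    · simp [h0]
    have hlt := hG I h0 fun u hu w hw h =>
      (mem_sdiff.1 hw).2 (G.mem_nbhd.2 ⟨u, (mem_sdiff.1 hu).1, h⟩)
    calc ∑ u ∈ I, c u ≤ #I * m := by
          simpa using Finset.sum_le_card_nsmul I c m fun u _ => hle u
      _ ≤ #((G.nbhd I).erase v) * m := by
          refine Nat.mul_le_mul_right m ?_
          have := Finset.pred_card_le_card_erase (s := G.nbhd I) (a := v)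
          omega
      _ = ∑ u ∈ (G.nbhd I).erase v, c u := by
          rw [Finset.sum_congr rfl fun u hu => hm u (Finset.ne_of_mem_erase hu)]; simp
      _ ≤ _ := Finset.sum_le_sum_of_subset (Finset.erase_subset _ _)
  omega

open scoped Classical in
theorem incidentSum_eq_sum (f : G.edgeSet → ℕ) (v : V) :
    G.incidentSum f v = ∑ u, if h : G.Adj v u then f ⟨s(v, u), h⟩ else 0 := by
  rw [incidentSum, Finset.sum_dite, Finset.sum_const_zero, add_zero]
  symm
  refine Finset.sum_bij (fun u _ => ⟨s(v, u.1), (mem_filter.1 u.2).2⟩) (fun u _ => by simp)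
    (fun a _ b _ h => ?_) (fun e he => ?_) (fun _ _ => rfl)
  · exact Subtype.ext (Sym2.congr_right.1 (congrArg Subtype.val h))
  · obtain ⟨e, hmem⟩ := e
    obtain ⟨u, rfl⟩ := (mem_filter.1 he).2
    exact ⟨⟨u, by simpa using hmem⟩, mem_attach _ _, rfl⟩

/-- A symmetric weighting supported on adjacent pairs is the same as a weighting of the edges. -/
theorem isKDCritical_of_weights {k d : ℕ} (h : ∀ v, ∃ w : V → V → ℕ, (∀ x y, w x y = w y x) ∧
    (∀ x y, ¬ G.Adj x y → w x y = 0) ∧ ∑ y, w v y = k - d ∧ ∀ x, x ≠ v → ∑ y, w x y = k) :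
    G.IsKDCritical k d := by
  classical
  intro v
  obtain ⟨w, hs, h0, hv, hx⟩ := h v
  let f : G.edgeSet → ℕ := fun e => Sym2.lift ⟨w, hs⟩ e.1
  have hf : ∀ x, G.incidentSum f x = ∑ y, w x y := fun x => by
    rw [incidentSum_eq_sum]
    refine Finset.sum_congr rfl fun y _ => ?_
    split_ifs with hxy
    · simp [f]
    · exact (h0 x y hxy).symm
  have hk : ∀ x, ∑ y, w x y ≤ k := fun x => by
    by_cases hxv : x = v
    · subst hxv; omega
    · exact (hx x hxv).le
  refine ⟨f, ⟨fun e => ?_, fun x => (hf x).trans_le (hk x)⟩, (hf v).trans hv,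
    fun u hu => (hf u).trans (hx u hu)⟩
  obtain ⟨e, he⟩ := e
  induction e with
  | _ x y =>
    exact (Finset.single_le_sum (f := w x) (fun _ _ => Nat.zero_le _) (mem_univ y)).trans (hk x)

/-- An independent set with too few neighbours obstructs criticality. -/
theorem not_isKDCritical {k d : ℕ} (hd : 1 ≤ d) (hdk : d < k) {I S : Finset V}
    (hS : S.Nonempty) (hdisj : Disjoint I S) (hcard : #S ≤ #I)
    (hN : ∀ u ∈ I, ∀ x, G.Adj u x → x ∈ S) : ¬ G.IsKDCritical k d := by
  classical
  intro hG
  -- Placing the deficiency inside `S` leaves total capacity below `#S * k`, while `I` sends `#I *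
  -- k` into `S`.
  obtain ⟨v, hv⟩ := hS
  obtain ⟨f, ⟨-, hk⟩, hfv, hfu⟩ := hG v
  set w : V → V → ℕ := fun x y => if h : G.Adj x y then f ⟨s(x, y), h⟩ else 0 with hw
  have hsum : ∀ x, G.incidentSum f x = ∑ y, w x y := G.incidentSum_eq_sum f
  have hsymm : ∀ x y, w x y = w y x := fun x y => by
    by_cases h : G.Adj x y
    · simp only [hw, h, h.symm, dif_pos]
      congr 2
      exact Sym2.eq_swap
    · have h' : ¬ G.Adj y x := fun h' => h h'.symm
      simp only [hw, h, h', dif_neg, not_false_iff]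
  have h1 : #I * k = ∑ u ∈ I, ∑ x ∈ S, w u x := by
    rw [← smul_eq_mul, ← Finset.sum_const]
    refine Finset.sum_congr rfl fun u hu => ?_
    rw [← hfu u (fun h => Finset.disjoint_left.1 hdisj hu (h ▸ hv)), hsum]
    symm
    refine Finset.sum_subset (subset_univ _) fun x _ hx => ?_
    exact dif_neg fun h => hx (hN u hu x h)
  have h2 : ∑ u ∈ I, ∑ x ∈ S, w u x ≤ ∑ x ∈ S, G.incidentSum f x := by
    rw [Finset.sum_comm]
    refine Finset.sum_le_sum fun x _ => ?_
    rw [hsum]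
    exact (Finset.sum_le_sum_of_subset (subset_univ I)).trans'
      (Finset.sum_le_sum fun u _ => (hsymm u x).le)
  have h3 : ∑ x ∈ S, G.incidentSum f x < ∑ x ∈ S, k :=
    Finset.sum_lt_sum (fun x _ => hk x) ⟨v, hv, by omega⟩
  rw [Finset.sum_const, smul_eq_mul] at h3
  have := Nat.mul_le_mul_right k hcard
  omega

end Transport

end SimpleGraph

namespace SimpleGraph

open Finset

/-! ### Counting non-adjacent pairs -/

section NonadjPairs

variable {V : Type*} [Fintype V] (G : SimpleGraph V)

open scoped Classical in
/-- The ordered pairs of distinct non-adjacent vertices. -/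
noncomputable def nonadjPairs : Finset (V × V) :=
  univ.filter fun p => p.1 ≠ p.2 ∧ ¬ G.Adj p.1 p.2

theorem mem_nonadjPairs {p : V × V} : p ∈ G.nonadjPairs ↔ p.1 ≠ p.2 ∧ ¬ G.Adj p.1 p.2 := by
  simp [nonadjPairs]

theorem even_card_nonadjPairs : Even #G.nonadjPairs := by
  have h : ∑ _p ∈ G.nonadjPairs, (1 : ZMod 2) = 0 := by
    refine Finset.sum_involution (fun p _ => p.swap) (fun _ _ => by decide)
      (fun p hp _ h => ?_) (fun p hp => ?_) (fun p _ => p.swap_swap)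
    · exact (G.mem_nonadjPairs.1 hp).1 (congrArg Prod.snd h)
    · have hp' := G.mem_nonadjPairs.1 hp
      exact G.mem_nonadjPairs.2 ⟨hp'.1.symm, fun h => hp'.2 h.symm⟩
  rw [Finset.sum_const, nsmul_one] at h
  exact even_iff_two_dvd.2 ((ZMod.natCast_eq_zero_iff _ _).1 h)

theorem card_nonadjPairs_add : (#G.nonadjPairs : ℝ) + ∑ u, ∑ v, G.adjInd u v
    = Fintype.card V * (Fintype.card V - 1) := by
  classical
  have h : (#G.nonadjPairs : ℝ) = ∑ u, ∑ v, (1 - (if u = v then 1 else 0) - G.adjInd u v) := by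
    rw [nonadjPairs, Finset.card_filter, Fintype.sum_prod_type]
    push_cast
    refine Finset.sum_congr rfl fun u _ => Finset.sum_congr rfl fun v _ => ?_
    by_cases huv : u = v
    · subst huv; simp [G.adjInd_of_not_adj G.irrefl]
    · by_cases ha : G.Adj u v
      · simp [ha, G.adjInd_of_adj ha, huv]
      · simp [ha, G.adjInd_of_not_adj ha, huv]
  rw [h]
  simp only [Finset.sum_sub_distrib, Finset.sum_ite_eq, mem_univ, if_true, Finset.sum_const,
    card_univ, nsmul_eq_mul, mul_one]
  ring

/-- Non-adjacent pairs of `H` pull back to non-adjacent pairs of `G`; equal counts leave no room for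
a further edge of `H`. -/
theorem nonempty_iso_of_card_nonadjPairs_le {W : Type*} [Fintype W] {H : SimpleGraph W}
    (φ : V ≃ W) (h : ∀ u v, G.Adj u v → H.Adj (φ u) (φ v))
    (hc : #G.nonadjPairs ≤ #H.nonadjPairs) : Nonempty (G ≃g H) := by
  classical
  have hsub : H.nonadjPairs.map (φ.prodCongr φ).symm.toEmbedding ⊆ G.nonadjPairs := by
    intro p hp
    rw [Finset.mem_map_equiv] at hp
    rw [mem_nonadjPairs] at hp ⊢
    exact ⟨fun h' => hp.1 (congrArg φ h'), fun h' => hp.2 (h _ _ h')⟩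
  have heq := Finset.eq_of_subset_of_card_le hsub (by rwa [Finset.card_map])
  refine ⟨⟨φ, fun {u v} => ⟨fun huv => ?_, h u v⟩⟩⟩
  by_contra hn
  have hp : (u, v) ∈ G.nonadjPairs :=
    G.mem_nonadjPairs.2 ⟨fun h' => huv.ne (congrArg φ h'), hn⟩
  rw [← heq, Finset.mem_map_equiv, mem_nonadjPairs] at hp
  exact hp.2 huv

theorem card_nonadjPairs_pendantCliqueGraph (n : ℕ) :
    #(pendantCliqueGraph n).nonadjPairs = 2 * (n - 2) := by
  have h := (pendantCliqueGraph n).card_nonadjPairs_add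
  have h2 := sum_adjInd_pendantCliqueGraph n 1
  have e : (Sum.elim (fun _ => 1) (Sum.elim (fun _ => 1) (fun _ => 1)) :
      Fin 1 ⊕ (Fin (n - 2) ⊕ Fin 1) → ℝ) = fun _ => 1 := by
    funext x; rcases x with x | x | x <;> rfl
  simp only [e, mul_one] at h2
  simp only [h2, Fintype.card_sum, Fintype.card_fin] at h
  push_cast at h
  have : (#(pendantCliqueGraph n).nonadjPairs : ℝ) = (2 * (n - 2) : ℕ) := by
    push_cast; linarith
  exact_mod_cast this

theorem card_nonadjPairs_halfSplitGraph (m : ℕ) :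
    #(halfSplitGraph m).nonadjPairs = m * (m - 1) := by
  have h := (halfSplitGraph m).card_nonadjPairs_add
  have h2 := sum_adjInd_halfSplitGraph m 1
  have e : (Sum.elim (fun _ => 1) (fun _ => 1) : Fin m ⊕ Fin m → ℝ) = fun _ => 1 := by
    funext x; rcases x with x | x <;> rfl
  simp only [e, mul_one] at h2
  simp only [h2, Fintype.card_sum, Fintype.card_fin] at h
  rcases m with _ | m
  · simp at h; simpa using h
  rw [Nat.add_sub_cancel]
  push_cast at h
  have : (#(halfSplitGraph (m + 1)).nonadjPairs : ℝ) = ((m + 1) * m : ℕ) := by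
    push_cast; linarith
  exact_mod_cast this

theorem card_nonadjPairs_le_sq_sub_sq (hρ : (Fintype.card V : ℝ) - 2 < G.adjRho)
    (hn : 2 ≤ Fintype.card V) :
    (#G.nonadjPairs : ℝ) ≤ (Fintype.card V - 1) ^ 2 - G.adjRho ^ 2 := by
  have : Nonempty V := Fintype.card_pos_iff.1 (by omega)
  have h := G.adjRho_sq_le (G.one_le_sum_adjInd hρ hn)
  have h2 := G.card_nonadjPairs_add
  nlinarith

/-- `(n-1)² - (n-2)² = 2(n-2) + 1`, and the inequality is strict. -/
theorem card_nonadjPairs_le (hρ : (Fintype.card V : ℝ) - 2 < G.adjRho)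
    (hn : 2 ≤ Fintype.card V) : #G.nonadjPairs ≤ 2 * (Fintype.card V - 2) := by
  have h := G.card_nonadjPairs_le_sq_sub_sq hρ hn
  have hn' : (2 : ℝ) ≤ Fintype.card V := by exact_mod_cast hn
  obtain ⟨m, hm⟩ : ∃ m, Fintype.card V = m + 2 := ⟨Fintype.card V - 2, by omega⟩
  rw [hm] at h hρ ⊢
  push_cast at h hρ
  rw [Nat.add_sub_cancel]
  have : (#G.nonadjPairs : ℝ) < (2 * m + 1 : ℕ) := by
    push_cast
    nlinarith [(Nat.cast_nonneg m : (0 : ℝ) ≤ m)]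
  have : #G.nonadjPairs < 2 * m + 1 := by exact_mod_cast this
  omega

theorem nbhd_disjoint {I : Finset V} (hI : ∀ u ∈ I, ∀ v ∈ I, ¬ G.Adj u v) :
    Disjoint I (G.nbhd I) := by
  rw [Finset.disjoint_left]
  intro x hx hx'
  obtain ⟨u, hu, hux⟩ := G.mem_nbhd.1 hx'
  exact hI u hu x hx hux

/-- An independent set with few neighbours forces many non-adjacent pairs. -/
theorem le_card_nonadjPairs {I : Finset V} (hI : ∀ u ∈ I, ∀ v ∈ I, ¬ G.Adj u v) :
    #I * #I - #I + 2 * (#I * (Fintype.card V - #I - #(G.nbhd I))) ≤ #G.nonadjPairs := by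
  classical
  -- No vertex of `I` is adjacent to one of `R`, so these pairs count in both orders, besides the
  -- pairs inside `I`.
  set R := (I ∪ G.nbhd I)ᶜ with hR
  have hRc : #R = Fintype.card V - #I - #(G.nbhd I) := by
    rw [hR, Finset.card_compl, Finset.card_union_of_disjoint (G.nbhd_disjoint hI)]
    omega
  have hIR : Disjoint I R := Finset.disjoint_left.2 fun x hx hx' => by
    rw [hR, mem_compl, mem_union] at hx'
    exact hx' (Or.inl hx)
  have hadj : ∀ u ∈ I, ∀ r ∈ R, ¬ G.Adj u r := fun u hu r hr h => by
    rw [hR, mem_compl, mem_union] at hr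
    exact hr (Or.inr (G.mem_nbhd.2 ⟨u, hu, h⟩))
  have hd1 : Disjoint I.offDiag (I ×ˢ R ∪ R ×ˢ I) := Finset.disjoint_left.2 fun p hp hp' => by
    rw [mem_offDiag] at hp
    rw [mem_union, mem_product, mem_product] at hp'
    rcases hp' with h | h
    · exact Finset.disjoint_left.1 hIR hp.2.1 h.2
    · exact Finset.disjoint_left.1 hIR hp.1 h.1
  have hd2 : Disjoint (I ×ˢ R) (R ×ˢ I) := Finset.disjoint_left.2 fun p hp hp' => by
    rw [mem_product] at hp hp'
    exact Finset.disjoint_left.1 hIR hp.1 hp'.1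
  have hsub : I.offDiag ∪ (I ×ˢ R ∪ R ×ˢ I) ⊆ G.nonadjPairs := by
    intro p hp
    rw [mem_nonadjPairs]
    simp only [mem_union, mem_offDiag, mem_product] at hp
    rcases hp with h | h | h
    · exact ⟨h.2.2, hI _ h.1 _ h.2.1⟩
    · exact ⟨fun e => Finset.disjoint_left.1 hIR h.1 (e ▸ h.2), hadj _ h.1 _ h.2⟩
    · exact ⟨fun e => Finset.disjoint_left.1 hIR h.2 (e ▸ h.1),
        fun h' => hadj _ h.2 _ h.1 h'.symm⟩
  have := Finset.card_le_card hsub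
  rw [Finset.card_union_of_disjoint hd1, Finset.card_union_of_disjoint hd2, offDiag_card,
    card_product, card_product, Nat.mul_comm #R #I, hRc] at this
  omega

end NonadjPairs

/-! ### Matchings by averaging, and criticality from expansion -/

section Critical

variable {V : Type*} (G : SimpleGraph V)

-- Missing edges of a pairing are seen from both ends. Excluding the value `1` lets an average below
-- `2` yield a pairing with no missing edge.
open scoped Classical in
theorem card_filter_not_adj_ne_one (f : V → V) (A : Finset V) (hA : ∀ x ∈ A, f x ∈ A)
    (hne : ∀ x ∈ A, f x ≠ x) (hinv : ∀ x, f (f x) = x) :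
    #(A.filter fun x => ¬ G.Adj x (f x)) ≠ 1 := by
  intro h
  obtain ⟨x, hx⟩ := Finset.card_eq_one.1 h
  have h1 : x ∈ A.filter fun x => ¬ G.Adj x (f x) := hx ▸ mem_singleton_self x
  rw [mem_filter] at h1
  have h2 : f x ∈ A.filter fun x => ¬ G.Adj x (f x) :=
    mem_filter.2 ⟨hA x h1.1, fun h' => h1.2 (by rw [hinv] at h'; exact h'.symm)⟩
  rw [hx, mem_singleton] at h2
  exact hne x h1.1 h2

variable [Fintype V]

open scoped Classical in
theorem sum_card_filter_not_adj_le {m : ℕ} (F : Fin m → V → V) (A : Finset V)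
    (hA : ∀ j, ∀ x ∈ A, F j x ∈ A) (hne : ∀ j, ∀ x ∈ A, F j x ≠ x)
    (hinj : ∀ j j', ∀ x ∈ A, F j x = F j' x → j = j') :
    ∑ j, #(A.filter fun x => ¬ G.Adj x (F j x))
      ≤ #(G.nonadjPairs.filter fun p => p.1 ∈ A ∧ p.2 ∈ A) := by
  rw [← Finset.card_sigma]
  refine Finset.card_le_card_of_injOn (fun s => (s.2, F s.1 s.2)) ?_ ?_
  · rintro ⟨j, x⟩ hs
    simp only [mem_coe, mem_sigma, mem_univ, true_and, mem_filter] at hs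
    simp only [mem_coe, mem_filter, mem_nonadjPairs]
    exact ⟨⟨(hne j x hs.1).symm, hs.2⟩, hs.1, hA j x hs.1⟩
  · rintro ⟨j, x⟩ hs ⟨j', x'⟩ hs' h
    simp only [mem_coe, mem_sigma, mem_univ, true_and, mem_filter] at hs
    obtain ⟨rfl, h2⟩ := Prod.mk.inj h
    obtain rfl := hinj j j' x hs.1 h2
    rfl

/-- A graph of even order with few non-adjacent pairs has a perfect matching. -/
theorem exists_perfect_involution {m : ℕ} (hm : Odd m) (hV : Fintype.card V = m + 1)
    (hP : #G.nonadjPairs < 2 * m) :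
    ∃ f : V → V, (∀ x, f (f x) = x) ∧ ∀ x, G.Adj x (f x) := by
  classical
  obtain ⟨F, hinv, hne, hinj⟩ := exists_oneFactorization hm hV
  have hs := G.sum_card_filter_not_adj_le F univ (fun _ _ _ => mem_univ _)
    (fun j x _ => hne j x) (fun j j' x _ => hinj j j' x)
  have hlt : ∑ j, #(univ.filter fun x => ¬ G.Adj x (F j x)) < ∑ _j : Fin m, 2 := by
    refine (hs.trans (Finset.card_filter_le _ _)).trans_lt ?_
    simpa [mul_comm] using hP
  obtain ⟨j, -, hj⟩ := Finset.exists_lt_of_sum_lt hlt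
  have h1 := G.card_filter_not_adj_ne_one (F j) univ (fun _ _ => mem_univ _)
    (fun x _ => hne j x) (hinv j)
  have h0 : #(univ.filter fun x => ¬ G.Adj x (F j x)) = 0 := by omega
  refine ⟨F j, hinv j, fun x => ?_⟩
  by_contra hx
  exact Finset.filter_eq_empty_iff.1 (Finset.card_eq_zero.1 h0) (mem_univ x) hx

/-- A near-perfect matching in which at most one pair is not an edge; if there is such a pair then
the exposed vertex is adjacent to all others. -/
theorem exists_nearPerfect_involution {m : ℕ} (hm : Odd m) (hV : Fintype.card V = m + 2)
    (hP : #G.nonadjPairs ≤ 2 * m) (v : V) :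
    ∃ f : V → V, (∀ x, f (f x) = x) ∧ (f v = v) ∧ (∀ x, x ≠ v → f x ≠ x) ∧
      ∃ B : Finset V, (∀ x, x ∈ B ↔ x ≠ v ∧ ¬ G.Adj x (f x)) ∧
        (B = ∅ ∨ #B = 2 ∧ ∀ x, x ≠ v → G.Adj v x) := by
  classical
  have hW : Fintype.card {x // x ≠ v} = m + 1 := by
    rw [Fintype.card_subtype_compl, Fintype.card_subtype_eq, hV]; rfl
  obtain ⟨F, hinv, hne, hinj⟩ := exists_oneFactorization hm hW
  let f : Fin m → V → V := fun j x => if h : x ≠ v then (F j ⟨x, h⟩).1 else v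
  have hf : ∀ j x (h : x ≠ v), f j x = (F j ⟨x, h⟩).1 := fun j x h => dif_pos h
  have hfv : ∀ j, f j v = v := fun j => by simp [f]
  have hfA : ∀ j x, x ≠ v → f j x ≠ v := fun j x h => by rw [hf j x h]; exact (F j ⟨x, h⟩).2
  have hfinv : ∀ j x, f j (f j x) = x := fun j x => by
    by_cases h : x = v
    · subst h; rw [hfv, hfv]
    · rw [hf j x h, hf j _ (F j ⟨x, h⟩).2, hinv]
  have hfne : ∀ j x, x ≠ v → f j x ≠ x := fun j x h h' => by
    rw [hf j x h] at h'
    exact hne j ⟨x, h⟩ (Subtype.ext h')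
  have hfinj : ∀ j j' x, x ≠ v → f j x = f j' x → j = j' := fun j j' x h h' => by
    rw [hf j x h, hf j' x h] at h'
    exact hinj j j' ⟨x, h⟩ (Subtype.ext h')
  set A : Finset V := univ.erase v with hA
  have hmemA : ∀ x, x ∈ A ↔ x ≠ v := fun x => by simp [hA]
  have hs := G.sum_card_filter_not_adj_le f A (fun j x hx => (hmemA _).2 (hfA j x ((hmemA x).1 hx)))
    (fun j x hx => hfne j x ((hmemA x).1 hx)) (fun j j' x hx => hfinj j j' x ((hmemA x).1 hx))
  have hone : ∀ j, #(A.filter fun x => ¬ G.Adj x (f j x)) ≠ 1 := fun j =>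
    G.card_filter_not_adj_ne_one (f j) A (fun x hx => (hmemA _).2 (hfA j x ((hmemA x).1 hx)))
      (fun x hx => hfne j x ((hmemA x).1 hx)) (hfinv j)
  suffices h : ∃ j, #(A.filter fun x => ¬ G.Adj x (f j x)) = 0 ∨
      #(A.filter fun x => ¬ G.Adj x (f j x)) = 2 ∧ ∀ x, x ≠ v → G.Adj v x by
    obtain ⟨j, hj⟩ := h
    exact ⟨f j, hfinv j, hfv j, hfne j, A.filter fun x => ¬ G.Adj x (f j x),
      fun x => by rw [mem_filter, hmemA], hj.imp_left Finset.card_eq_zero.1⟩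
  -- If `v` sees every vertex, an average of at most `2` suffices. Otherwise a missing pair at `v`
  -- lies outside `A`, so the average drops below `2` and some pairing is perfect on `A`.
  by_cases huniv : ∀ x, x ≠ v → G.Adj v x
  · have : Nonempty (Fin m) := ⟨⟨0, hm.pos⟩⟩
    have hle : ∑ j, #(A.filter fun x => ¬ G.Adj x (f j x)) ≤ ∑ _j : Fin m, 2 := by
      refine (hs.trans (Finset.card_filter_le _ _)).trans ?_
      simpa [mul_comm] using hP
    obtain ⟨j, -, hj⟩ := Finset.exists_le_of_sum_le univ_nonempty hle
    refine ⟨j, ?_⟩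
    have := hone j
    rcases (by omega : #(A.filter fun x => ¬ G.Adj x (f j x)) = 0 ∨
      #(A.filter fun x => ¬ G.Adj x (f j x)) = 2) with h | h
    · exact Or.inl h
    · exact Or.inr ⟨h, huniv⟩
  · push Not at huniv
    obtain ⟨u, huv, hu⟩ := huniv
    have hlt : #(G.nonadjPairs.filter fun p => p.1 ∈ A ∧ p.2 ∈ A) < #G.nonadjPairs := by
      refine Finset.card_lt_card (Finset.filter_ssubset.2 ⟨(v, u), ?_, fun h => ?_⟩)
      · exact G.mem_nonadjPairs.2 ⟨huv.symm, hu⟩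
      · exact (hmemA v).1 h.1 rfl
    have hlt' : ∑ j, #(A.filter fun x => ¬ G.Adj x (f j x)) < ∑ _j : Fin m, 2 := by
      refine (hs.trans_lt hlt).trans_le ?_
      simpa [mul_comm] using hP
    obtain ⟨j, -, hj⟩ := Finset.exists_lt_of_sum_lt hlt'
    have := hone j
    exact ⟨j, Or.inl (by omega)⟩

/-- A symmetric weighting with odd sums off `v` extends to the weighting required at `v`. -/
theorem IndepExpanding.exists_weights (hG : G.IndepExpanding) {k d g : ℕ} (hk : Odd k)
    (hd : 1 ≤ d) {v : V} (w : V → V → ℕ) (hs : ∀ x y, w x y = w y x)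
    (h0 : ∀ x y, ¬ G.Adj x y → w x y = 0) (hv : ∑ y, w v y = g)
    (hx : ∀ x, x ≠ v → ∑ y, w x y = 1) (hg : g ≤ k - d) (hpar : Even (k - d - g)) :
    ∃ w : V → V → ℕ, (∀ x y, w x y = w y x) ∧
      (∀ x y, ¬ G.Adj x y → w x y = 0) ∧ ∑ y, w v y = k - d ∧ ∀ x, x ≠ v → ∑ y, w x y = k := by
  classical
  obtain ⟨a, ha⟩ := hk
  obtain ⟨b, hb⟩ := hpar
  -- Half of what is still missing at each vertex: `2a + 1 = k` off `v`, and `2b + g = k - d` at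
  -- `v`.
  let c : V → ℕ := fun u => if u = v then b else a
  have hcv : c v = b := if_pos rfl
  have hcu : ∀ u, u ≠ v → c u = a := fun u hu => if_neg hu
  obtain ⟨x, hx0, hxr, hxc⟩ := G.exists_transport c
    (hG.sum_le G (m := a) (v := v) hcu (by rw [hcv]; omega))
  refine ⟨fun u y => w u y + (x u y + x y u), fun u y => by beta_reduce; rw [hs u y, add_comm (x u y)],
    fun u y h => ?_, ?_, fun u hu => ?_⟩
  · beta_reduce
    rw [h0 u y h, hx0 u y h, hx0 y u fun h' => h h'.symm]
  · rw [Finset.sum_add_distrib, Finset.sum_add_distrib, hv, hxr, hxc, hcv]; omega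
  · rw [Finset.sum_add_distrib, Finset.sum_add_distrib, hx u hu, hxr, hxc, hcu u hu]; omega

theorem IndepExpanding.isKDCritical (hG : G.IndepExpanding) {n k d : ℕ} (hn : 3 ≤ n)
    (hV : Fintype.card V = n) (hkodd : Odd k) (hd : 1 ≤ d) (hdk : d < k)
    (hnd : n ≡ d [MOD 2]) (hP : #G.nonadjPairs ≤ 2 * (n - 2)) : G.IsKDCritical k d := by
  classical
  refine G.isKDCritical_of_weights fun v => ?_
  have hk2 := Nat.odd_iff.1 hkodd
  unfold Nat.ModEq at hnd
  rcases Nat.even_or_odd n with he | ho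
  · have he2 := Nat.even_iff.1 he
    obtain ⟨f, hinv, hadj⟩ := G.exists_perfect_involution (m := n - 1)
      (Nat.odd_iff.2 (by omega)) (by omega) (by omega)
    have hsum : ∀ x, ∑ y, (if y = f x then 1 else 0) = 1 := fun x => by simp
    -- Here `d` is even, so `k - d` is odd and the perfect matching has the right parity at `v`.
    refine hG.exists_weights G hkodd hd (g := 1) (fun x y => if y = f x then 1 else 0)
      (fun x y => ?_) (fun x y h => ?_) (hsum v) (fun x _ => hsum x) (by omega)
      (Nat.even_iff.2 (by omega))
    · have : y = f x ↔ x = f y := ⟨fun h => by rw [h, hinv], fun h => by rw [h, hinv]⟩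
      simp only [this]
    · exact if_neg fun h' => h (by rw [h']; exact hadj x)
  · have ho2 := Nat.odd_iff.1 ho
    obtain ⟨f, hinv, hfv, -, B, hB, hcase⟩ := G.exists_nearPerfect_involution (m := n - 2)
      (Nat.odd_iff.2 (by omega)) (by omega) hP v
    have hvB : v ∉ B := fun h => ((hB v).1 h).1 rfl
    have hc : #B = 0 ∨ #B = 2 := hcase.imp Finset.card_eq_zero.2 And.left
    have hadjB : ∀ x ∈ B, G.Adj v x := fun x hx => by
      rcases hcase with h | h
      · rw [h] at hx; simp at hx
      · exact h.2 x ((hB x).1 hx).1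
    -- Here `k - d` is even and positive, so it accommodates `#B = 0` or `2`. The pair in `B`, when
    -- not empty, is served by two edges at `v`.
    refine hG.exists_weights G hkodd hd (g := #B) (v := v)
      (fun x y => (if y = f x ∧ G.Adj x y then 1 else 0) + ((if x = v ∧ y ∈ B then 1 else 0)
        + (if y = v ∧ x ∈ B then 1 else 0))) (fun x y => ?_) (fun x y h => ?_) ?_ (fun x hx => ?_)
      (by omega) (Nat.even_iff.2 (by omega))
    · have : y = f x ↔ x = f y := ⟨fun h => by rw [h, hinv], fun h => by rw [h, hinv]⟩
      simp only [this, G.adj_comm x y]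
      omega
    · rw [if_neg fun h' => h h'.2, if_neg, if_neg]
      · rintro ⟨rfl, hx⟩; exact h (hadjB x hx).symm
      · rintro ⟨rfl, hy⟩; exact h (hadjB y hy)
    · have : ∀ y, ¬ (y = f v ∧ G.Adj v y) := fun y h => by
        rw [hfv] at h; exact h.2.ne h.1.symm
      simp [this, hvB]
    · rw [Finset.sum_add_distrib, Finset.sum_add_distrib]
      have e1 : ∑ y, (if x = v ∧ y ∈ B then 1 else 0) = 0 := by simp [hx]
      have e2 : ∑ y, (if y = v ∧ x ∈ B then 1 else 0) = if x ∈ B then 1 else 0 := by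
        by_cases h : x ∈ B <;> simp [h]
      have e3 : ∑ y, (if y = f x ∧ G.Adj x y then 1 else 0) = if G.Adj x (f x) then 1 else 0 := by
        rw [Finset.sum_eq_single (f x)]
        · simp
        · intro y _ hy; simp [hy]
        · simp
      rw [e1, e2, e3]
      by_cases h : G.Adj x (f x)
      · rw [if_pos h, if_neg fun h' => ((hB x).1 h').2 h, add_zero, add_zero]
      · rw [if_neg h, if_pos ((hB x).2 ⟨hx, h⟩), zero_add, zero_add]

end Critical

end SimpleGraph

namespace SimpleGraph

open Finset

/-! ### Identification of the extremal graphs -/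

section Structure

variable {V : Type*} [Fintype V] (G : SimpleGraph V)

theorem exists_equiv_of_two {W : Type*} [Fintype W] (h : Fintype.card V = Fintype.card W)
    {a b : V} (hab : a ≠ b) {p q : W} (hpq : p ≠ q) : ∃ φ : V ≃ W, φ a = p ∧ φ b = q := by
  classical
  obtain ⟨e⟩ := Fintype.card_eq.1 h
  have ha : (e.trans (Equiv.swap (e a) p)) a = p := by simp
  refine ⟨(e.trans (Equiv.swap (e a) p)).trans
    (Equiv.swap ((e.trans (Equiv.swap (e a) p)) b) q), ?_, by simp⟩
  rw [Equiv.trans_apply, ha]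
  refine Equiv.swap_apply_of_ne_of_ne (fun h => hab ?_) hpq
  exact (e.trans (Equiv.swap (e a) p)).injective (ha.trans h)

theorem nonempty_iso_pendantCliqueGraph {n : ℕ} (hn : 3 ≤ n) (hV : Fintype.card V = n)
    (hP : #G.nonadjPairs ≤ 2 * (n - 2)) {w c : V} (hwc : w ≠ c)
    (hw : ∀ x, G.Adj w x → x = c) : Nonempty (G ≃g pendantCliqueGraph n) := by
  obtain ⟨φ, hφw, hφc⟩ := exists_equiv_of_two
    (W := Fin 1 ⊕ (Fin (n - 2) ⊕ Fin 1))
    (by simp only [Fintype.card_sum, Fintype.card_fin]; omega) hwc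
    (p := Sum.inr (Sum.inr 0)) (q := Sum.inl 0) (by simp)
  refine G.nonempty_iso_of_card_nonadjPairs_le φ (fun u v huv => ?_)
    (hP.trans_eq (card_nonadjPairs_pendantCliqueGraph n).symm)
  have hne : φ u ≠ φ v := fun h => huv.ne (φ.injective h)
  have h1 : φ u = Sum.inr (Sum.inr 0) → φ v = Sum.inl 0 := fun h => by
    have : u = w := φ.injective (h.trans hφw.symm)
    subst this
    rw [hw v huv, hφc]
  have h2 : φ v = Sum.inr (Sum.inr 0) → φ u = Sum.inl 0 := fun h => by
    have : v = w := φ.injective (h.trans hφw.symm)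
    subst this
    rw [hw u huv.symm, hφc]
  rcases hu : φ u with a | a | a <;> rcases hv : φ v with b | b | b
  · exact absurd (by rw [hu, hv, Subsingleton.elim a b]) hne
  · exact graphJoin_adj_inl_inr _ _
  · exact graphJoin_adj_inl_inr _ _
  · exact graphJoin_adj_inr_inl _ _
  · rw [graphJoin_adj_inr_inr]
    exact fun h => hne (by rw [hu, hv, h])
  · simpa [hu] using h2 (by rw [hv, Subsingleton.elim b 0])
  · exact graphJoin_adj_inr_inl _ _
  · simpa [hv] using h1 (by rw [hu, Subsingleton.elim a 0])
  · simpa [hv] using h1 (by rw [hu, Subsingleton.elim a 0])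

theorem nonempty_iso_halfSplitGraph {m : ℕ} (hV : Fintype.card V = 2 * m)
    (hP : #G.nonadjPairs ≤ m * (m - 1)) {I : Finset V} (hc : #I = m)
    (hI : ∀ u ∈ I, ∀ v ∈ I, ¬ G.Adj u v) : Nonempty (G ≃g halfSplitGraph m) := by
  classical
  obtain ⟨e1⟩ : Nonempty ({x // x ∈ I} ≃ Fin m) := by
    rw [← Fintype.card_eq, Fintype.card_coe, Fintype.card_fin, hc]
  obtain ⟨e2⟩ : Nonempty ({x // x ∉ I} ≃ Fin m) := by
    rw [← Fintype.card_eq, Fintype.card_subtype_compl, Fintype.card_coe, Fintype.card_fin, hc, hV]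
    omega
  let φ : V ≃ Fin m ⊕ Fin m :=
    ((Equiv.sumCompl (fun x => x ∈ I)).symm.trans (Equiv.sumComm _ _)).trans (e2.sumCongr e1)
  have hφ : ∀ x i, φ x = Sum.inr i → x ∈ I := fun x i h => by
    by_contra hx
    simp [φ, Equiv.sumCompl_symm_apply_of_neg, hx] at h
  refine G.nonempty_iso_of_card_nonadjPairs_le φ (fun u v huv => ?_)
    (hP.trans_eq (card_nonadjPairs_halfSplitGraph m).symm)
  have hne : φ u ≠ φ v := fun h => huv.ne (φ.injective h)
  rcases hu : φ u with a | a <;> rcases hv : φ v with b | b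
  · rw [graphJoin_adj_inl_inl]
    exact fun h => hne (by rw [hu, hv, h])
  · exact graphJoin_adj_inl_inr a b
  · exact graphJoin_adj_inr_inl b a
  · exact absurd huv (hI u (hφ u a hu) v (hφ v b hv))

theorem not_isKDCritical_of_iso_pendantCliqueGraph {n k d : ℕ} (hd : 1 ≤ d) (hdk : d < k)
    (φ : G ≃g pendantCliqueGraph n) : ¬ G.IsKDCritical k d := by
  refine G.not_isKDCritical hd hdk (I := {φ.symm (Sum.inr (Sum.inr 0))})
    (S := {φ.symm (Sum.inl 0)}) (singleton_nonempty _) ?_ (by simp) fun u hu x hux => ?_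
  · rw [Finset.disjoint_singleton]
    exact fun h => by simpa using φ.symm.injective h
  · rw [mem_singleton] at hu ⊢
    subst hu
    rw [← φ.map_adj_iff, φ.apply_symm_apply] at hux
    rcases h : φ x with a | a | a
    · rw [← φ.symm_apply_apply x, h, Subsingleton.elim a 0]
    · rw [h, graphJoin_adj_inr_inr] at hux; simp at hux
    · rw [h, graphJoin_adj_inr_inr, Subsingleton.elim a 0] at hux; simp at hux

theorem not_isKDCritical_of_iso_halfSplitGraph {m k d : ℕ} (hm : 0 < m) (hd : 1 ≤ d) (hdk : d < k)
    (φ : G ≃g halfSplitGraph m) : ¬ G.IsKDCritical k d := by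
  classical
  have : Nonempty (Fin m) := ⟨⟨0, hm⟩⟩
  refine G.not_isKDCritical hd hdk (I := univ.image fun i => φ.symm (Sum.inr i))
    (S := univ.image fun i => φ.symm (Sum.inl i)) (univ_nonempty.image _) ?_ ?_ fun u hu x hux => ?_
  · rw [Finset.disjoint_left]
    rintro _ hx hx'
    obtain ⟨i, -, rfl⟩ := mem_image.1 hx
    obtain ⟨j, -, h⟩ := mem_image.1 hx'
    simpa using φ.symm.injective h
  · rw [Finset.card_image_of_injective _ fun i j h => Sum.inl_injective (φ.symm.injective h),
      Finset.card_image_of_injective _ fun i j h => Sum.inr_injective (φ.symm.injective h)]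
  · obtain ⟨i, -, rfl⟩ := mem_image.1 hu
    rw [← φ.map_adj_iff, φ.apply_symm_apply] at hux
    rcases h : φ x with a | a
    · exact mem_image.2 ⟨a, mem_univ _, by rw [← h, φ.symm_apply_apply]⟩
    · rw [h, graphJoin_adj_inr_inr] at hux; simp at hux

theorem exists_pendant_of_card_nbhd_le_one (hV : 2 ≤ Fintype.card V) {I : Finset V}
    (hne : I.Nonempty) (hI : ∀ u ∈ I, ∀ v ∈ I, ¬ G.Adj u v) (h1 : #(G.nbhd I) ≤ 1) :
    ∃ w c, w ≠ c ∧ ∀ x, G.Adj w x → x = c := by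
  obtain ⟨w, hw⟩ := hne
  have hx : ∀ x, G.Adj w x → x ∈ G.nbhd I := fun x h => G.mem_nbhd.2 ⟨w, hw, h⟩
  rcases (G.nbhd I).eq_empty_or_nonempty with h0 | ⟨c, hc⟩
  · have : Nontrivial V := Fintype.one_lt_card_iff_nontrivial.1 hV
    obtain ⟨c, hc⟩ := exists_ne w
    exact ⟨w, c, hc.symm, fun x h => by have := hx x h; rw [h0] at this; simp at this⟩
  · exact ⟨w, c, fun h => Finset.disjoint_left.1 (G.nbhd_disjoint hI) hw (h ▸ hc),
      fun x h => Finset.card_le_one.1 h1 x (hx x h) c hc⟩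

theorem not_indepExpanding (h : ¬ G.IndepExpanding) : ∃ I : Finset V, I.Nonempty ∧
    (∀ u ∈ I, ∀ v ∈ I, ¬ G.Adj u v) ∧ #(G.nbhd I) ≤ #I := by
  unfold IndepExpanding at h
  push Not at h
  exact h

/-- Numerical possibilities for an independent set with few neighbours in a dense graph. -/
theorem indep_cases {n i s t P : ℕ} (hn : n = i + s + t) (hi : 1 ≤ i) (hs : s ≤ i)
    (h : i * i - i + 2 * (i * t) ≤ P) (hP : P ≤ 2 * (n - 2)) (hn3 : 3 ≤ n) :
    i = 1 ∨ (i = 2 ∧ s = 1 ∧ t = 0) ∨ (i = 2 ∧ s = 2 ∧ t = 0) ∨ (i = 2 ∧ s = 2 ∧ t = 1) ∨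
      (i = 3 ∧ s = 2 ∧ t = 0) ∨ (i = 3 ∧ s = 3 ∧ t = 0) ∨ (i = 4 ∧ s = 4 ∧ t = 0) := by
  -- With `s ≤ i` the bounds give `i² - i + 2it ≤ 4i + 2t - 4`, hence `(i - 1)(i - 4) ≤ 0`.
  have hi4 : i ≤ 4 := by
    by_contra hc
    obtain ⟨j, rfl⟩ : ∃ j, i = j + 5 := ⟨i - 5, by omega⟩
    have e : (j + 5) * (j + 5) - (j + 5) = j * j + 9 * j + 20 := by
      rw [show (j + 5) * (j + 5) = j * j + 9 * j + 20 + (j + 5) by ring, Nat.add_sub_cancel]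
    rw [e] at h
    have : t ≤ (j + 5) * t := Nat.le_mul_of_pos_left t (by omega)
    omega
  interval_cases i <;> omega

theorem nonempty_iso_pendantCliqueGraph_of_adjRho {n : ℕ} (hn : 3 ≤ n)
    (hV : Fintype.card V = n) (hρ : (n : ℝ) - 2 < G.adjRho) (hn4 : n ≠ 4) (hn6 : n ≠ 6)
    (hG : ¬ G.IndepExpanding) : Nonempty (G ≃g pendantCliqueGraph n) := by
  classical
  have : Nonempty V := Fintype.card_pos_iff.1 (by omega)
  have hP := G.card_nonadjPairs_le (by rwa [hV]) (by omega)
  obtain ⟨I, hne, hI, hc⟩ := G.not_indepExpanding hG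
  have hle := G.le_card_nonadjPairs hI
  have hsum : #I + #(G.nbhd I) ≤ n := by
    rw [← Finset.card_union_of_disjoint (G.nbhd_disjoint hI), ← hV]
    exact Finset.card_le_univ _
  rw [hV] at hP hle
  -- Both configurations have `ρ ≤ n - 2`, certified by weight `2/3` on `J`; for `n = 5` both
  -- inequalities in the certificate are equalities.
  have key : ∀ J : Finset V, (∀ u ∈ J, ∀ v ∈ J, ¬ G.Adj u v) →
      ¬ ((n = 5 ∧ #J = 3) ∨ (n = 8 ∧ #J = 4)) := by
    rintro J hJ (⟨rfl, h⟩ | ⟨rfl, h⟩)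
    · have := G.adjRho_le_of_indep J hJ (c := 2 / 3) (l := 3) (by norm_num)
        (by rw [hV, h]; norm_num) (by rw [hV, h]; norm_num)
      norm_num at hρ
      linarith
    · have := G.adjRho_le_of_indep J hJ (c := 2 / 3) (l := 6) (by norm_num)
        (by rw [hV, h]; norm_num) (by rw [hV, h]; norm_num)
      norm_num at hρ
      linarith
  have hcases := indep_cases (n := n) (by omega) hne.card_pos hc hle hP hn
  by_cases h1 : #(G.nbhd I) ≤ 1
  · obtain ⟨w, c, hwc, hw⟩ := G.exists_pendant_of_card_nbhd_le_one (by omega) hne hI h1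
    exact G.nonempty_iso_pendantCliqueGraph hn hV hP hwc hw
  exfalso
  have hkey := key I hI
  -- What remains is two vertices with two neighbours and one vertex `r` outside both; adding `r` to
  -- `I` gives the excluded independent triple.
  have h2 : #I = 2 ∧ n = 5 := by omega
  obtain ⟨r, hr⟩ : ∃ r, r ∉ I ∪ G.nbhd I := by
    by_contra! hall
    have : #(I ∪ G.nbhd I) = n := by rw [Finset.eq_univ_of_forall hall, card_univ, hV]
    have := Finset.card_union_le I (G.nbhd I)
    omega
  rw [mem_union, not_or] at hr
  have hadj : ∀ u ∈ I, ¬ G.Adj u r := fun u hu h => hr.2 (G.mem_nbhd.2 ⟨u, hu, h⟩)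
  refine key (insert r I) (fun u hu v hv => ?_)
    (Or.inl ⟨h2.2, by rw [Finset.card_insert_of_notMem hr.1, h2.1]⟩)
  rw [mem_insert] at hu hv
  rcases hu with rfl | hu <;> rcases hv with rfl | hv
  · exact G.irrefl
  · exact fun h => hadj v hv h.symm
  · exact hadj u hu
  · exact hI u hu v hv

theorem nonempty_iso_halfSplitGraph_of_not_indepExpanding {m : ℕ} (hm : m = 2 ∨ m = 3)
    (hV : Fintype.card V = 2 * m) (hP : #G.nonadjPairs ≤ m * (m - 1))
    (hG : ¬ G.IndepExpanding) : Nonempty (G ≃g halfSplitGraph m) := by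
  classical
  obtain ⟨I, hne, hI, hc⟩ := G.not_indepExpanding hG
  have hle := G.le_card_nonadjPairs hI
  have hsum : #I + #(G.nbhd I) ≤ 2 * m := by
    rw [← Finset.card_union_of_disjoint (G.nbhd_disjoint hI), ← hV]
    exact Finset.card_le_univ _
  rw [hV] at hle
  have hpos := hne.card_pos
  have hIle : #I ≤ 2 * m := by omega
  have : #I = m := by
    generalize #(G.nbhd I) = s at *
    generalize #I = i at *
    rcases hm with rfl | rfl <;> interval_cases i <;> omega
  exact G.nonempty_iso_halfSplitGraph hV hP this hI

/-- Hong's bound gives a count below `m(m-1) + 2`; since the count and `m(m-1)` are even, it drops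
to `m(m-1)`. -/
theorem card_nonadjPairs_le_of_halfSplitGraph {m : ℕ} (hm : m = 2 ∨ m = 3)
    (hV : Fintype.card V = 2 * m) (hρ : (halfSplitGraph m).adjRho ≤ G.adjRho) :
    #G.nonadjPairs ≤ m * (m - 1) := by
  have hlow : (2 * m : ℝ) - 2 < G.adjRho ∧
      (2 * m - 1 : ℝ) ^ 2 - G.adjRho ^ 2 < m * (m - 1) + 2 := by
    rcases hm with rfl | rfl
    · have := le_adjRho_halfSplitGraph_two.trans hρ
      norm_num
      constructor <;> nlinarith
    · have := le_adjRho_halfSplitGraph_three.trans hρ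
      norm_num at this ⊢
      constructor <;> nlinarith
  have h := G.card_nonadjPairs_le_sq_sub_sq (by rw [hV]; push_cast; exact hlow.1) (by omega)
  rw [hV] at h
  push_cast at h
  have h' : (#G.nonadjPairs : ℝ) < (m * (m - 1) + 2 : ℕ) := by
    rw [Nat.cast_add, Nat.cast_mul, Nat.cast_sub (by omega)]
    push_cast
    linarith [hlow.2]
  have : #G.nonadjPairs < m * (m - 1) + 2 := by exact_mod_cast h'
  have := Nat.even_iff.1 G.even_card_nonadjPairs
  rcases hm with rfl | rfl <;> omega

end Structure

end SimpleGraph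

theorem theorem5p2 {V : Type*} [Fintype V] (G : SimpleGraph V) (n k d : ℕ)
    (hn : 3 ≤ n) (hV : Fintype.card V = n) (hk : 3 ≤ k) (hkodd : Odd k)
    (hd : 1 ≤ d) (hdk : d < k) (hnd : n ≡ d [MOD 2]) :
    ((7 ≤ n ∨ n = 3 ∨ n = 5) →
      (SimpleGraph.pendantCliqueGraph n).adjRho ≤ G.adjRho →
      (G.IsKDCritical k d ↔ ¬ Nonempty (G ≃g SimpleGraph.pendantCliqueGraph n))) ∧
    ((n = 4 ∨ n = 6) →
      (SimpleGraph.halfSplitGraph (n / 2)).adjRho ≤ G.adjRho →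
      (G.IsKDCritical k d ↔ ¬ Nonempty (G ≃g SimpleGraph.halfSplitGraph (n / 2)))) := by
  refine ⟨fun hn' hρ => ⟨fun hG ⟨φ⟩ =>
    G.not_isKDCritical_of_iso_pendantCliqueGraph hd hdk φ hG, fun hiso => ?_⟩,
    fun hn' hρ => ⟨fun hG ⟨φ⟩ =>
      G.not_isKDCritical_of_iso_halfSplitGraph (by omega) hd hdk φ hG, fun hiso => ?_⟩⟩
  · have hρ' := (SimpleGraph.sub_two_lt_adjRho_pendantCliqueGraph hn).trans_le hρ
    have hexp : G.IndepExpanding := by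
      by_contra hG
      exact hiso (G.nonempty_iso_pendantCliqueGraph_of_adjRho hn hV hρ' (by omega) (by omega) hG)
    refine hexp.isKDCritical G hn hV hkodd hd hdk hnd ?_
    rw [← hV]
    exact G.card_nonadjPairs_le (by rwa [hV]) (by omega)
  · have hm : n / 2 = 2 ∨ n / 2 = 3 := by omega
    have hV' : Fintype.card V = 2 * (n / 2) := by omega
    have hP := G.card_nonadjPairs_le_of_halfSplitGraph hm hV' hρ
    have hexp : G.IndepExpanding := by
      by_contra hG
      exact hiso (G.nonempty_iso_halfSplitGraph_of_not_indepExpanding hm hV' hP hG)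
    refine hexp.isKDCritical G hn hV hkodd hd hdk hnd (hP.trans ?_)
    rcases hn' with rfl | rfl <;> norm_num
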